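/- For $n\ge 1$ let $N=2^n$ and let $Q_n$ be the Hamming cube, i.e. the graph on $\{0,1\}^n$ in which two strings are adjacent iff they differ in exactly one coordinate; $\log$ denotes $\log_2$. Let $\mathcal I$ be the set of (inclusion-)maximal independent sets of $Q_n$. An induced matching of $Q_n$ is an induced subgraph that is a matching; its size is its number of edges. For $I\in\mathcal I$ let $m(I)$ be the largest size of an induced matching $M$ of $Q_n$ such that every edge of $M$ meets $I$ and no edge of $Q_n$ joins a vertex of $V(M)$ to a vertex of $I\setminus V(M)$. Put $$\mathcal J=\Big\{I\in\mathcal I:\ m(I)>\Big(1-\frac{\log^3 n}{n}\Big)\frac N4\Big\}.$$ Then $|\mathcal I\setminus\mathcal J|=o(2^{N/4})$ as $n\to\infty$. In fact, there are constants $c>0$ and $n_0$ such that for all $n\ge n_0$ $$\log|\mathcal I\setminus\mathcal J|<\Big(1-c\,\frac{\log^3 n}{n}\Big)\frac N4$$ (with $\log 0=-\infty$). -/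

import Mathlib

namespace HammingMIS

/-- The Hamming cube `Q_n`: the graph on `{0,1}^n` in which two strings are adjacent
if they differ in exactly one coordinate. -/
def cube (n : ℕ) : SimpleGraph (Fin n → Bool) where
  Adj x y := hammingDist x y = 1
  symm := ⟨fun x y h => by rw [hammingDist_comm]; exact h⟩
  loopless := ⟨fun x h => by simp at h⟩

/-- The set of (inclusion-)maximal independent sets of `G`. -/
def maxIndepSets {V : Type*} (G : SimpleGraph V) : Set (Set V) :=
  {I | Maximal G.IsIndepSet I}

/-- `M` is an induced matching of `G`: an induced subgraph that is a matching. -/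
def IsInducedMatching {V : Type*} {G : SimpleGraph V} (M : G.Subgraph) : Prop :=
  M.IsInduced ∧ M.IsMatching

/-- `I ∼ M`: each edge of `M` meets `I`. -/
def MeetsEdges {V : Type*} {G : SimpleGraph V} (I : Set V) (M : G.Subgraph) : Prop :=
  ∀ e ∈ M.edgeSet, ∃ v ∈ e, v ∈ I

/-- `∇(V(M), I \ V(M)) = ∅`: no edge of `G` joins `V(M)` to `I \ V(M)`. -/
def NoOuterEdges {V : Type*} {G : SimpleGraph V} (I : Set V) (M : G.Subgraph) : Prop :=
  ∀ v ∈ M.verts, ∀ w ∈ I \ M.verts, ¬ G.Adj v w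

/-- The sizes (numbers of edges) of the induced matchings `M` of `G` with `I ∼ M`
and `∇(V(M), I \ V(M)) = ∅`. -/
def matchingSizes {V : Type*} (G : SimpleGraph V) (I : Set V) : Set ℕ :=
  {k | ∃ M : G.Subgraph, IsInducedMatching M ∧ MeetsEdges I M ∧ NoOuterEdges I M ∧
    M.edgeSet.ncard = k}

/-- `m_G(I)`: the largest of these sizes (`G` is finite in all uses; see
`isGreatest_matchingNumber`). -/
noncomputable def matchingNumber {V : Type*} (G : SimpleGraph V) (I : Set V) : ℕ :=
  sSup (matchingSizes G I)

/-- On a finite graph the largest size exists, and `m_G(I)` is that size. -/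
theorem isGreatest_matchingNumber {V : Type*} [Finite V] (G : SimpleGraph V) (I : Set V) :
    IsGreatest (matchingSizes G I) (matchingNumber G I) := by
  have hne : (matchingSizes G I).Nonempty := by
    refine ⟨0, ⊥, ⟨?_, ?_⟩, ?_, ?_, ?_⟩
    · intro v hv; simp at hv
    · intro v hv; simp at hv
    · intro e he; simp at he
    · intro v hv; simp at hv
    · simp
  have hbdd : BddAbove (matchingSizes G I) := by
    refine ⟨Nat.card (Sym2 V), ?_⟩
    rintro k ⟨M, -, -, -, rfl⟩
    exact Set.ncard_le_card _
  exact ⟨Nat.sSup_mem hne hbdd, fun k hk => le_csSup hbdd hk⟩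

/-- `log³ n / n`, with `log = log₂`. -/
noncomputable def logRatio (n : ℕ) : ℝ := Real.logb 2 n ^ 3 / n

/-- `𝓙`: the maximal independent sets `I` of `Q_n` with `m(I) > (1 - log³ n / n) N / 4`,
where `N = 2^n`. -/
def largeMatchingSets (n : ℕ) : Set (Set (Fin n → Bool)) :=
  {I | I ∈ maxIndepSets (cube n) ∧
    (matchingNumber (cube n) I : ℝ) > (1 - logRatio n) * ((2 : ℝ) ^ n / 4)}

end HammingMIS
open scoped Asymptotics

/-! The count combines a container-style branching with a stability form of the Hujter–Tuza bound.

Stability (`card_family_le`): a triangle-free graph on `m` vertices has at most `√2 ^ m` maximal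
independent sets, the extremal case being a perfect matching of isolated edges. In the branching
proof of this bound, every branch other than the one on an isolated edge still works with `7 / 5 <
√2` in place of `√2`. Each isolated edge used adds two vertices to a matched set, so if matched sets
have at most `s` vertices, the loss is only `mu ^ s` with `mu = √2 / (7 / 5)`. For `s = m` this
returns `√2 ^ m`; for smaller `s` it saves `mu ^ (m - s)`.

Containers (`card_family_le_of_regular`): the bound is useful only when `m` is close to `N / 2`,
while the cube has `N` vertices. A set larger than `N / 2` has a vertex of large induced degree.
Branching on whether that vertex lies in `I` leaves at most `N / 2 + N / n` vertices, at a cost of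
`2 ^ O(N log² n / n)`. Outside `𝓙` one has `s = (1 - log³ n / n) N / 2`, so the saving is `2 ^ Ω(N
log³ n / n)`, which outweighs the cost. -/

namespace HammingMIS

/-! ### Maximal independent sets and matched sets under vertex deletion -/

section Families

open Classical Finset

variable {V : Type*} (G : SimpleGraph V)

/-- `I` is a maximal independent set of the subgraph of `G` induced on `X`. -/
def IsMaxIndepIn (X I : Finset V) : Prop :=
  I ⊆ X ∧ (∀ x ∈ I, ∀ y ∈ I, ¬ G.Adj x y) ∧ ∀ x ∈ X, x ∉ I → ∃ y ∈ I, G.Adj x y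

/-- `S ⊆ X` is the vertex set of an induced matching each of whose edges meets `I`, with no edge
of `G` joining `S` to `I \ S`. -/
def IsMatchedBy (X I S : Finset V) : Prop :=
  S ⊆ X ∧ (∀ v ∈ S, ∃! w, w ∈ S ∧ G.Adj v w) ∧
    (∀ v ∈ S, ∀ w ∈ S, G.Adj v w → v ∈ I ∨ w ∈ I) ∧ ∀ v ∈ S, ∀ w ∈ I, w ∉ S → ¬ G.Adj v w

/-- The neighbours of `v` in `X`. -/
noncomputable def nbrs (X : Finset V) (v : V) : Finset V := {w ∈ X | G.Adj v w}

/-- `X` with the closed neighbourhood of `v` removed. -/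
noncomputable def removeClosed (X : Finset V) (v : V) : Finset V := {w ∈ X | w ≠ v ∧ ¬ G.Adj v w}

variable {G} {X Y I S : Finset V} {s : ℝ} {u v w : V}

lemma mem_nbrs : w ∈ nbrs G X v ↔ w ∈ X ∧ G.Adj v w := by simp [nbrs]

lemma mem_removeClosed : w ∈ removeClosed G X v ↔ w ∈ X ∧ w ≠ v ∧ ¬ G.Adj v w := by
  simp [removeClosed]

lemma removeClosed_subset : removeClosed G X v ⊆ X := filter_subset _ _

lemma card_removeClosed (hv : v ∈ X) :
    #(removeClosed G X v) + #(nbrs G X v) + 1 = #X := by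
  have h1 : removeClosed G X v = X \ insert v (nbrs G X v) := by
    ext w
    simp only [mem_removeClosed, mem_sdiff, mem_insert, mem_nbrs]
    tauto
  have h2 : insert v (nbrs G X v) ⊆ X := insert_subset hv (filter_subset _ _)
  have h3 : #(insert v (nbrs G X v)) = #(nbrs G X v) + 1 :=
    card_insert_of_notMem (by simp [mem_nbrs])
  have h4 := card_sdiff_add_card_eq_card h2
  rw [h1]
  omega

lemma IsMaxIndepIn.removeClosed (hI : IsMaxIndepIn G X I) (hu : u ∈ I) :
    IsMaxIndepIn G (removeClosed G X u) (I.erase u) := by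
  obtain ⟨h1, h2, h3⟩ := hI
  refine ⟨fun x hx => ?_, fun x hx y hy => h2 x (mem_of_mem_erase hx) y (mem_of_mem_erase hy),
    fun x hx hxI => ?_⟩
  · have := mem_of_mem_erase hx
    exact mem_removeClosed.2 ⟨h1 this, ne_of_mem_erase hx, h2 u hu x this⟩
  · obtain ⟨hxX, hxu, hux⟩ := mem_removeClosed.1 hx
    obtain ⟨y, hy, hxy⟩ := h3 x hxX (fun h => hxI (mem_erase.2 ⟨hxu, h⟩))
    refine ⟨y, mem_erase.2 ⟨?_, hy⟩, hxy⟩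
    rintro rfl
    exact hux hxy.symm

/-- No vertex left after deleting the closed neighbourhood of `u` is adjacent to `u`, so returning
`u` to the independent set creates no edge to `S`. -/
lemma IsMatchedBy.of_removeClosed (h : IsMatchedBy G (removeClosed G X u) (I.erase u) S) :
    IsMatchedBy G X I S := by
  obtain ⟨h1, h2, h3, h4⟩ := h
  refine ⟨h1.trans removeClosed_subset, h2, fun v hv w hw hvw => ?_, fun v hv w hw hwS hvw => ?_⟩
  · exact (h3 v hv w hw hvw).imp mem_of_mem_erase mem_of_mem_erase
  · by_cases hwu : w = u
    · subst hwu
      exact (mem_removeClosed.1 (h1 hv)).2.2 hvw.symm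
    · exact h4 v hv w (mem_erase.2 ⟨hwu, hw⟩) hwS hvw

/-- Adding an isolated edge `uv` of `G[X]` to a matched vertex set. -/
lemma IsMatchedBy.insert_edge (hI : IsMaxIndepIn G X I) (hu : u ∈ I) (hvX : v ∈ X)
    (huv : nbrs G X u = {v}) (hvu : nbrs G X v = {u})
    (h : IsMatchedBy G (HammingMIS.removeClosed G X u) (I.erase u) S) :
    IsMatchedBy G X I (insert u (insert v S)) ∧ #(insert u (insert v S)) = #S + 2 := by
  have hS : IsMatchedBy G X I S := h.of_removeClosed
  have hSX := h.1
  obtain ⟨h1, h2, h3, h4⟩ := hS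
  have hu' : ∀ w ∈ X, G.Adj u w ↔ w = v := fun w hw => by
    have : w ∈ nbrs G X u ↔ w = v := by rw [huv, mem_singleton]
    rw [← this, mem_nbrs]; tauto
  have hv' : ∀ w ∈ X, G.Adj v w ↔ w = u := fun w hw => by
    have : w ∈ nbrs G X v ↔ w = u := by rw [hvu, mem_singleton]
    rw [← this, mem_nbrs]; tauto
  have huX := hI.1 hu
  have hadj : G.Adj u v := (hu' v hvX).2 rfl
  have huS : u ∉ S := fun hh => (mem_removeClosed.1 (hSX hh)).2.1 rfl
  have hvS : v ∉ S := fun hh => (mem_removeClosed.1 (hSX hh)).2.2 hadj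
  have hsub : insert u (insert v S) ⊆ X := insert_subset huX (insert_subset hvX h1)
  -- Within `X` the only neighbour of `u` is `v` and conversely, and both lie outside `S`.
  have hSu : ∀ x ∈ S, ¬ G.Adj x u := fun x hx hxu =>
    hvS (((hu' x (h1 hx)).1 hxu.symm) ▸ hx)
  have hSv : ∀ x ∈ S, ¬ G.Adj x v := fun x hx hxv =>
    huS (((hv' x (h1 hx)).1 hxv.symm) ▸ hx)
  refine ⟨⟨hsub, ?_, ?_, ?_⟩, ?_⟩
  · intro x hx
    rcases mem_insert.1 hx with rfl | hx1
    · exact ⟨v, ⟨by simp, hadj⟩, fun y hy => (hu' y (hsub hy.1)).1 hy.2⟩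
    rcases mem_insert.1 hx1 with rfl | hx2
    · exact ⟨u, ⟨by simp, hadj.symm⟩, fun y hy => (hv' y (hsub hy.1)).1 hy.2⟩
    obtain ⟨y, hy, hy'⟩ := h2 x hx2
    refine ⟨y, ⟨by simp [hy.1], hy.2⟩, fun z hz => ?_⟩
    rcases mem_insert.1 hz.1 with rfl | hzz
    · exact absurd hz.2 (hSu x hx2)
    rcases mem_insert.1 hzz with rfl | hzz
    · exact absurd hz.2 (hSv x hx2)
    exact hy' z ⟨hzz, hz.2⟩
  · intro x hx y hy hxy
    rcases mem_insert.1 hx with rfl | hx'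
    · exact Or.inl hu
    rcases mem_insert.1 hx' with rfl | hx2
    · exact Or.inr (((hv' y (hsub hy)).1 hxy) ▸ hu)
    rcases mem_insert.1 hy with rfl | hy'
    · exact Or.inr hu
    rcases mem_insert.1 hy' with rfl | hy'
    · exact absurd hxy (hSv x hx2)
    exact h3 x hx2 y hy' hxy
  · intro x hx y hy hyS hxy
    simp only [mem_insert, not_or] at hyS
    rcases mem_insert.1 hx with rfl | hx'
    · exact hyS.2.1 ((hu' y (hI.1 hy)).1 hxy)
    rcases mem_insert.1 hx' with rfl | hx'
    · exact hyS.1 ((hv' y (hI.1 hy)).1 hxy)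
    exact h4 x hx' y hy hyS.2.2 hxy
  · rw [card_insert_of_notMem, card_insert_of_notMem hvS]
    simp [huS, hadj.ne]

lemma erase_injOn_filter_mem (F : Finset (Finset V)) (u : V) :
    Set.InjOn (fun I : Finset V => I.erase u) (F.filter (u ∈ ·) : Set (Finset V)) := by
  intro I hI J hJ h
  simp only [coe_filter, Set.mem_ofPred_eq] at hI hJ
  rw [← insert_erase hI.2, ← insert_erase hJ.2]
  exact congrArg _ h

lemma mem_or_mem_of_nbrs_eq_singleton (hv : v ∈ X) (h : nbrs G X v = {u})
    (hI : IsMaxIndepIn G X I) : v ∈ I ∨ u ∈ I := by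
  by_contra! hc
  obtain ⟨y, hy, hvy⟩ := hI.2.2 v hv hc.1
  have : y ∈ nbrs G X v := mem_nbrs.2 ⟨hI.1 hy, hvy⟩
  rw [h, mem_singleton] at this
  exact hc.2 (this ▸ hy)

/-! ### Branching inequalities for the families -/

variable [Fintype V]

/-- The maximal independent sets of `G[X]` whose matched vertex sets all have size at most `s`. -/
noncomputable def family (G : SimpleGraph V) (X : Finset V) (s : ℝ) : Finset (Finset V) :=
  {I | IsMaxIndepIn G X I ∧ ∀ S, IsMatchedBy G X I S → (#S : ℝ) ≤ s}

lemma mem_family : I ∈ family G X s ↔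
    IsMaxIndepIn G X I ∧ ∀ S, IsMatchedBy G X I S → (#S : ℝ) ≤ s := by
  simp [family]

lemma card_family_filter_mem_le (G : SimpleGraph V) (X : Finset V) (s : ℝ) (u : V) :
    #{I ∈ family G X s | u ∈ I} ≤ #(family G (removeClosed G X u) s) := by
  refine card_le_card_of_injOn _ (fun I hI => ?_) (erase_injOn_filter_mem _ u)
  simp only [coe_filter, Set.mem_ofPred_eq, mem_family] at hI
  exact mem_family.2 ⟨hI.1.1.removeClosed hI.2, fun S hS => hI.1.2 S hS.of_removeClosed⟩

/-- The edge `uv` extends every matched set of the smaller graph by two vertices, so the allowance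
drops to `s - 2`. This is the source of the stability gain. -/
lemma card_family_filter_mem_le_of_isolated_edge (hv : v ∈ X) (huv : nbrs G X u = {v})
    (hvu : nbrs G X v = {u}) :
    #{I ∈ family G X s | u ∈ I} ≤ #(family G (removeClosed G X u) (s - 2)) := by
  refine card_le_card_of_injOn _ (fun I hI => ?_) (erase_injOn_filter_mem _ u)
  simp only [coe_filter, Set.mem_ofPred_eq, mem_family] at hI
  refine mem_family.2 ⟨hI.1.1.removeClosed hI.2, fun S hS => ?_⟩
  obtain ⟨h1, h2⟩ := hS.insert_edge hI.1.1 hI.2 hv huv hvu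
  have := hI.1.2 _ h1
  rw [h2] at this
  push_cast at this
  linarith

lemma family_filter_notMem_subset (G : SimpleGraph V) (X : Finset V) (s : ℝ) (u : V) :
    {I ∈ family G X s | u ∉ I} ⊆ family G (X.erase u) s := by
  intro I hI
  simp only [mem_filter, mem_family] at hI ⊢
  obtain ⟨⟨⟨h1, h2, h3⟩, h4⟩, hu⟩ := hI
  exact ⟨⟨fun x hx => mem_erase.2 ⟨fun h => hu (h ▸ hx), h1 hx⟩, h2,
    fun x hx => h3 x (mem_of_mem_erase hx)⟩,
    fun S hS => h4 S ⟨hS.1.trans (erase_subset _ _), hS.2⟩⟩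

lemma card_family_le_erase_add_removeClosed (G : SimpleGraph V) (X : Finset V) (s : ℝ) (u : V) :
    #(family G X s) ≤ #(family G (X.erase u) s) + #(family G (removeClosed G X u) s) := by
  have h1 := card_family_filter_mem_le G X s u
  have h2 := card_le_card (family_filter_notMem_subset G X s u)
  have h3 := card_filter_add_card_filter_not (s := family G X s) (p := (u ∈ ·))
  omega

lemma card_family_le_filter_add_filter (hv : v ∈ X) (h : nbrs G X v = {u}) :
    #(family G X s) ≤ #{I ∈ family G X s | v ∈ I} + #{I ∈ family G X s | u ∈ I} := by
  refine (card_le_card fun I hI => ?_).trans (card_union_le _ _)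
  have := mem_or_mem_of_nbrs_eq_singleton hv h (mem_family.1 hI).1
  simp only [mem_union, mem_filter]
  tauto

lemma card_family_le_of_leaf (hv : v ∈ X) (h : nbrs G X v = {u}) :
    #(family G X s) ≤
      #(family G (removeClosed G X v) s) + #(family G (removeClosed G X u) s) :=
  (card_family_le_filter_add_filter hv h).trans
    (add_le_add (card_family_filter_mem_le G X s v) (card_family_filter_mem_le G X s u))

lemma card_family_le_of_isolated_edge (hv : v ∈ X) (hu : u ∈ X) (hvu : nbrs G X v = {u})
    (huv : nbrs G X u = {v}) :
    #(family G X s) ≤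
      #(family G (removeClosed G X v) (s - 2)) + #(family G (removeClosed G X u) (s - 2)) :=
  (card_family_le_filter_add_filter hv hvu).trans
    (add_le_add (card_family_filter_mem_le_of_isolated_edge hu hvu huv)
      (card_family_filter_mem_le_of_isolated_edge hv huv hvu))

lemma card_family_le_of_isolated (hv : v ∈ X) (h : nbrs G X v = ∅) :
    #(family G X s) ≤ #(family G (removeClosed G X v) s) := by
  refine le_trans (card_le_card fun I hI => ?_) (card_family_filter_mem_le G X s v)
  refine mem_filter.2 ⟨hI, ?_⟩
  by_contra hc
  have hI' := (mem_family.1 hI).1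
  obtain ⟨y, hy, hvy⟩ := hI'.2.2 v hv hc
  have : y ∈ nbrs G X v := mem_nbrs.2 ⟨hI'.1 hy, hvy⟩
  simp [h] at this

/-! ### The stability bound for triangle-free graphs -/

/-- The growth rate `√2 / (7/5)`; its square is `50/49`. -/
noncomputable def mu : ℝ := 5 * √2 / 7

lemma mu_sq : mu ^ 2 = 50 / 49 := by
  rw [mu, div_pow, mul_pow, Real.sq_sqrt (by norm_num)]; norm_num

lemma one_lt_mu : 1 < mu := by
  have h : 0 ≤ mu := by unfold mu; positivity
  nlinarith [mu_sq]

lemma mu_pos : 0 < mu := one_pos.trans one_lt_mu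

/-- The allowance may have become negative during the branching; the family is then empty, because
`∅` is itself a matched set. -/
lemma card_family_empty_le : (#(family G ∅ s) : ℝ) ≤ mu ^ s := by
  have h : ∀ I ∈ family G ∅ s, I = ∅ ∧ 0 ≤ s := fun I hI => by
    obtain ⟨h1, h2⟩ := mem_family.1 hI
    exact ⟨subset_empty.1 h1.1, by simpa using h2 ∅ (by simp [IsMatchedBy])⟩
  by_cases hs : 0 ≤ s
  · have h1 : #(family G ∅ s) ≤ 1 :=
      card_le_one.2 fun a ha b hb => (h a ha).1.trans (h b hb).1.symm
    calc (#(family G ∅ s) : ℝ) ≤ 1 := by exact_mod_cast h1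
      _ ≤ mu ^ s := Real.one_le_rpow one_lt_mu.le hs
  · have : family G ∅ s = ∅ := eq_empty_of_forall_notMem fun I hI => hs (h I hI).2
    rw [this]
    simpa using (Real.rpow_pos_of_pos mu_pos s).le

/-- A stability form of the Hujter–Tuza bound: in a triangle-free graph few maximal independent
sets have only small matched vertex sets. -/
theorem card_family_le (hG : ∀ a b c, G.Adj a b → G.Adj b c → ¬ G.Adj a c) (X : Finset V)
    (s : ℝ) : (#(family G X s) : ℝ) ≤ mu ^ s * (7 / 5) ^ #X := by
  induction hm : #X using Nat.strong_induction_on generalizing X s with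
  | _ m ih =>
  subst hm
  -- Deleting `j` vertices gains a factor `(5 / 7) ^ j`, so each branching below reduces to a
  -- numerical inequality.
  have key : ∀ (Y : Finset V) (t : ℝ) (j : ℕ), 0 < j → #Y + j ≤ #X →
      (#(family G Y t) : ℝ) ≤ mu ^ t * (7 / 5) ^ #X * (5 / 7) ^ j := by
    intro Y t j hj hYX
    have h1 : mu ^ t * (7 / 5) ^ #X * (5 / 7) ^ j = mu ^ t * (7 / 5) ^ (#X - j) := by
      obtain ⟨i, hi⟩ : ∃ i, #X = i + j := ⟨#X - j, by omega⟩
      rw [hi, pow_add, Nat.add_sub_cancel, mul_assoc, mul_assoc, ← mul_pow]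
      norm_num
    rw [h1]
    refine (ih #Y (by omega) Y t rfl).trans ?_
    refine mul_le_mul_of_nonneg_left ?_ (Real.rpow_pos_of_pos mu_pos t).le
    exact pow_le_pow_right₀ (by norm_num) (by omega)
  have hpos : 0 < mu ^ s * (7 / 5) ^ #X :=
    mul_pos (Real.rpow_pos_of_pos mu_pos s) (by positivity)
  by_cases h3 : ∃ v ∈ X, 3 ≤ #(nbrs G X v)
  · obtain ⟨v, hv, hd⟩ := h3
    have hc := card_removeClosed (G := G) hv
    have he := card_erase_add_one hv
    -- The branch closes since `5/7 + (5/7)^4 < 1`.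
    have h1 := key (X.erase v) s 1 (by omega) (by omega)
    have h2 := key (removeClosed G X v) s 4 (by omega) (by omega)
    have h := (Nat.cast_le (α := ℝ)).2 (card_family_le_erase_add_removeClosed G X s v)
    push_cast at h
    nlinarith
  by_cases h0 : ∃ v ∈ X, #(nbrs G X v) = 0
  · obtain ⟨v, hv, hd⟩ := h0
    have hc := card_removeClosed (G := G) hv
    have h1 := key (removeClosed G X v) s 1 (by omega) (by omega)
    have h := (Nat.cast_le (α := ℝ)).2 (card_family_le_of_isolated (s := s) hv (card_eq_zero.1 hd))
    nlinarith
  by_cases h1 : ∃ v ∈ X, #(nbrs G X v) = 1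
  · obtain ⟨v, hv, hd⟩ := h1
    obtain ⟨u, hu⟩ := card_eq_one.1 hd
    have huX : u ∈ X ∧ G.Adj v u := mem_nbrs.1 (hu ▸ mem_singleton_self u)
    have hcv := card_removeClosed (G := G) hv
    have hcu := card_removeClosed (G := G) huX.1
    have hvu : v ∈ nbrs G X u := mem_nbrs.2 ⟨hv, huX.2.symm⟩
    by_cases hdu : #(nbrs G X u) = 1
    · have huv : nbrs G X u = {v} := by
        obtain ⟨w, hw⟩ := card_eq_one.1 hdu
        rw [hw, mem_singleton] at hvu
        rw [hw, hvu]
      -- The tight case, which determines `mu`: `2 * (5/7)^2 * mu^(-2) = 1`.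
      have h1 := key (removeClosed G X v) (s - 2) 2 (by omega) (by omega)
      have h2 := key (removeClosed G X u) (s - 2) 2 (by omega) (by omega)
      have h := (Nat.cast_le (α := ℝ)).2 (card_family_le_of_isolated_edge (s := s) hv huX.1 hu huv)
      push_cast at h
      have hmu : mu ^ (s - 2) = mu ^ s * (49 / 50) := by
        rw [Real.rpow_sub mu_pos, Real.rpow_two, mu_sq]; ring
      rw [hmu] at h1 h2
      nlinarith
    · have := card_pos.2 ⟨v, hvu⟩
      -- Here `u` has degree at least 2, and `(5/7)^2 + (5/7)^3 < 1`.
      have h1 := key (removeClosed G X v) s 2 (by omega) (by omega)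
      have h2 := key (removeClosed G X u) s 3 (by omega) (by omega)
      have h := (Nat.cast_le (α := ℝ)).2 (card_family_le_of_leaf (s := s) hv hu)
      push_cast at h
      nlinarith
  -- What remains is 2-regular. After excluding `v`, its neighbour `u` is a leaf attached to `w`,
  -- and triangle-freeness keeps both neighbours of `w`. The branches delete 3, 3 and 4 vertices,
  -- and `2 * (5/7)^3 + (5/7)^4 < 1`.
  have hdeg : ∀ v ∈ X, #(nbrs G X v) = 2 := fun v hv => by
    have a : ¬ 3 ≤ #(nbrs G X v) := fun h => h3 ⟨v, hv, h⟩
    have b : ¬ #(nbrs G X v) = 0 := fun h => h0 ⟨v, hv, h⟩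
    have c : ¬ #(nbrs G X v) = 1 := fun h => h1 ⟨v, hv, h⟩
    omega
  rcases X.eq_empty_or_nonempty with rfl | ⟨v, hv⟩
  · simpa using card_family_empty_le
  obtain ⟨u, hu⟩ : (nbrs G X v).Nonempty := card_pos.1 (by rw [hdeg v hv]; norm_num)
  obtain ⟨huX, hvu⟩ := mem_nbrs.1 hu
  have hvnu : v ∈ nbrs G X u := mem_nbrs.2 ⟨hv, hvu.symm⟩
  obtain ⟨w, hw⟩ := card_eq_one.1 (by rw [card_erase_of_mem hvnu, hdeg u huX] :
    #((nbrs G X u).erase v) = 1)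
  obtain ⟨hwv, hw'⟩ := mem_erase.1 (hw ▸ mem_singleton_self w : w ∈ (nbrs G X u).erase v)
  obtain ⟨hwX, huw⟩ := mem_nbrs.1 hw'
  have herase : ∀ z, nbrs G (X.erase v) z = (nbrs G X z).erase v := fun z => by
    ext y; simp only [mem_nbrs, mem_erase]; tauto
  have huY : u ∈ X.erase v := mem_erase.2 ⟨hvu.ne', huX⟩
  have hwY : w ∈ X.erase v := mem_erase.2 ⟨hwv, hwX⟩
  have hvnw : v ∉ nbrs G X w := fun h => hG v u w hvu huw (mem_nbrs.1 h).2.symm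
  have hcv := card_removeClosed (G := G) hv
  have hcu := card_removeClosed (G := G) huY
  have hcw := card_removeClosed (G := G) hwY
  rw [herase, hw, card_singleton] at hcu
  rw [herase, erase_eq_of_notMem hvnw, hdeg w hwX] at hcw
  rw [hdeg v hv] at hcv
  have he := card_erase_add_one hv
  have k1 := key (removeClosed G X v) s 3 (by omega) (by omega)
  have k2 := key (removeClosed G (X.erase v) u) s 3 (by omega) (by omega)
  have k3 := key (removeClosed G (X.erase v) w) s 4 (by omega) (by omega)
  have h := (Nat.cast_le (α := ℝ)).2 (card_family_le_erase_add_removeClosed G X s v)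
  have h' := (Nat.cast_le (α := ℝ)).2 (card_family_le_of_leaf (s := s) huY ((herase u).trans hw))
  push_cast at h h'
  nlinarith

/-! ### Container branching in regular graphs -/

/-- In an `n`-regular graph, a set of vertices larger than half contains a vertex with many
neighbours in it. -/
lemma exists_large_nbrs {n : ℕ} (hreg : ∀ v, #(nbrs G univ v) = n)
    (hX : (Fintype.card V : ℝ) / 2 < #X) :
    ∃ v ∈ X, 2 * n * (#X - (Fintype.card V : ℝ) / 2) / Fintype.card V ≤ #(nbrs G X v) := by
  have hdc : ∑ v, #(nbrs G X v) = n * #X := by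
    have h := sum_card_bipartiteAbove_eq_sum_card_bipartiteBelow (s := (univ : Finset V)) (t := X)
      G.Adj
    have h1 : ∀ v, bipartiteAbove G.Adj X v = nbrs G X v := fun v => rfl
    have h2 : ∀ v, bipartiteBelow G.Adj univ v = nbrs G univ v := fun v => by
      ext w; simp [mem_nbrs, G.adj_comm]
    simp only [h1, h2, hreg, sum_const, smul_eq_mul] at h
    rw [h, mul_comm]
  have hcompl : ∑ v ∈ Xᶜ, #(nbrs G X v) ≤ n * #Xᶜ := by
    have : ∑ v ∈ Xᶜ, #(nbrs G X v) ≤ ∑ v ∈ Xᶜ, n := sum_le_sum fun v _ => by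
      rw [← hreg v]
      exact card_le_card (filter_subset_filter _ (subset_univ _))
    simpa [mul_comm] using this
  have hsum := sum_add_sum_compl X (fun v => #(nbrs G X v))
  have hcard := card_add_card_compl X
  have hsumR : (∑ v ∈ X, (#(nbrs G X v) : ℝ)) + ∑ v ∈ Xᶜ, (#(nbrs G X v) : ℝ) = n * #X := by
    rw [hdc] at hsum; exact_mod_cast hsum
  have hcomplR : ∑ v ∈ Xᶜ, (#(nbrs G X v) : ℝ) ≤ n * #Xᶜ := by exact_mod_cast hcompl
  have hcardR : (#X : ℝ) + #Xᶜ = Fintype.card V := by exact_mod_cast hcard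
  set N : ℝ := (Fintype.card V : ℝ) with hN
  have hN0 : 0 ≤ N := by positivity
  have hXpos : (0 : ℝ) < #X := by linarith
  have hXN : (#X : ℝ) ≤ N := by linarith [(Nat.cast_nonneg _ : (0 : ℝ) ≤ #Xᶜ)]
  have hNpos : 0 < N := by linarith
  refine exists_le_of_sum_le (card_pos.1 (by exact_mod_cast hXpos)) ?_
  rw [sum_const, nsmul_eq_mul, ← mul_div_assoc, div_le_iff₀ hNpos]
  -- The degrees into `X` sum to `n * #X`, and the complement accounts for at most `n * (N - #X)` of
  -- this.
  have hlow : 2 * n * ((#X : ℝ) - N / 2) ≤ ∑ v ∈ X, (#(nbrs G X v) : ℝ) := by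
    have : (#Xᶜ : ℝ) = N - #X := by linarith
    rw [this] at hcomplR
    linarith
  have h0 : 0 ≤ 2 * n * ((#X : ℝ) - N / 2) :=
    mul_nonneg (by positivity) (by linarith)
  nlinarith

/-- Branching on vertices of large degree until at most `N / 2 + r` vertices are left. -/
theorem card_family_le_of_regular {n : ℕ} (hreg : ∀ v, #(nbrs G univ v) = n) {r p B : ℝ}
    (hr : 0 < r) (hp : 0 < p) (hp1 : p ≤ 1)
    (hB : ∀ Y : Finset V, (#Y : ℝ) ≤ (Fintype.card V : ℝ) / 2 + r → (#(family G Y s) : ℝ) ≤ B)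
    (k : ℕ) (X : Finset V)
    (hX : ((#X : ℝ) - (Fintype.card V : ℝ) / 2) * Real.exp (-(2 * n * k / Fintype.card V)) ≤ r) :
    (#(family G X s) : ℝ) ≤ B * ((1 + p) ^ #X * p⁻¹ ^ k) := by
  induction hm : #X using Nat.strong_induction_on generalizing X k with
  | _ m ih =>
  subst hm
  set N : ℝ := (Fintype.card V : ℝ) with hN
  have hp' : 1 ≤ p⁻¹ := (one_le_inv₀ hp).2 hp1
  by_cases hle : (#X : ℝ) ≤ N / 2 + r
  · have h1 := hB X hle
    have hB0 : 0 ≤ B := (Nat.cast_nonneg _).trans h1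
    refine h1.trans (le_mul_of_one_le_right hB0 ?_)
    exact one_le_mul_of_one_le_of_one_le (one_le_pow₀ (by linarith)) (one_le_pow₀ hp')
  push Not at hle
  -- With no inclusions left the exponential is 1, so `hX` already contradicts `#X > N / 2 + r`.
  cases k with
  | zero => simp at hX; linarith
  | succ k =>
    obtain ⟨v, hv, hd⟩ := exists_large_nbrs (X := X) hreg (by linarith)
    rw [← hN] at hd
    have hc := card_removeClosed (G := G) hv
    have he := card_erase_add_one hv
    have hcR : (#(removeClosed G X v) : ℝ) + #(nbrs G X v) + 1 = #X := by exact_mod_cast hc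
    have heR : (#(X.erase v) : ℝ) + 1 = #X := by exact_mod_cast he
    have h1 := ih _ (by omega) (k + 1) (X.erase v) (by
      refine le_trans (mul_le_mul_of_nonneg_right ?_ (Real.exp_pos _).le) hX
      linarith) rfl
    -- Including `v` multiplies the excess over `N / 2` by at most `1 - 2n/N ≤ exp (-2n/N)`, which
    -- pays for one unit of `k`.
    have h2 := ih _ (by omega) k (removeClosed G X v) (by
      refine le_trans ?_ hX
      have hexp : Real.exp (-(2 * n * ((k + 1 : ℕ) : ℝ) / N)) =
          Real.exp (-(2 * n / N)) * Real.exp (-(2 * n * k / N)) := by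
        rw [← Real.exp_add]; congr 1; push_cast; ring
      rw [hexp, ← mul_assoc]
      refine mul_le_mul_of_nonneg_right ?_ (Real.exp_pos _).le
      have h3 := Real.add_one_le_exp (-(2 * n / N))
      have h4 : ((#X : ℝ) - N / 2) * (-(2 * n / N) + 1) ≤
          ((#X : ℝ) - N / 2) * Real.exp (-(2 * n / N)) :=
        mul_le_mul_of_nonneg_left h3 (by linarith)
      refine le_trans ?_ h4
      have h5 : 2 * n * ((#X : ℝ) - N / 2) / N = ((#X : ℝ) - N / 2) * (2 * n / N) := by ring
      rw [h5] at hd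
      linarith) rfl
    have hB0 : 0 ≤ B := by
      refine (Nat.cast_nonneg _).trans (hB ∅ ?_)
      rw [card_empty, Nat.cast_zero]
      positivity
    have h := (Nat.cast_le (α := ℝ)).2 (card_family_le_erase_add_removeClosed G X s v)
    push_cast at h
    have h6 : (1 + p) ^ #(removeClosed G X v) ≤ (1 + p) ^ #(X.erase v) :=
      pow_le_pow_right₀ (by linarith) (by omega)
    have h7 : B * ((1 + p) ^ #(removeClosed G X v) * p⁻¹ ^ k) ≤
        B * ((1 + p) ^ #(X.erase v) * p⁻¹ ^ k) := by gcongr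
    -- The weight `(1 + p) ^ m * p⁻¹ ^ k` satisfies Pascal's recurrence exactly, and so bounds the
    -- number of branches with at most `k` inclusions.
    have h8 : B * ((1 + p) ^ #X * p⁻¹ ^ (k + 1)) =
        B * ((1 + p) ^ #(X.erase v) * p⁻¹ ^ (k + 1)) + B * ((1 + p) ^ #(X.erase v) * p⁻¹ ^ k) := by
      rw [← he, pow_succ (1 + p), pow_succ p⁻¹]
      field_simp
    rw [h8]
    linarith

end Families
end HammingMIS
namespace HammingMIS

/-! ### From matched vertex sets to induced matchings -/

section Bridge

open Classical Finset

variable {V : Type*} [Fintype V] {G : SimpleGraph V}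

/-- The subgraph induced on `S` is an admissible matching whose edges cover `S`, two vertices each.
-/
lemma IsMatchedBy.card_le {I : Set V} {S : Finset V}
    (h : IsMatchedBy G univ I.toFinset S) : #S ≤ 2 * matchingNumber G I := by
  obtain ⟨-, h2, h3, h4⟩ := h
  set M : G.Subgraph := (⊤ : G.Subgraph).induce S with hM
  have hadj : ∀ a b, M.Adj a b ↔ a ∈ S ∧ b ∈ S ∧ G.Adj a b := fun a b => by simp [hM]
  have hmem : M.edgeSet.ncard ∈ matchingSizes G I := by
    refine ⟨M, ⟨fun v hv w hw hvw => (hadj v w).2 ⟨hv, hw, hvw⟩, fun v hv => ?_⟩, ?_, ?_, rfl⟩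
    · obtain ⟨w, hw, hw'⟩ := h2 v hv
      exact ⟨w, (hadj v w).2 ⟨hv, hw⟩, fun y hy => hw' y ((hadj v y).1 hy).2⟩
    · intro e he
      induction e with
      | _ a b =>
        obtain ⟨ha, hb, hab⟩ := (hadj a b).1 he
        rcases h3 a ha b hb hab with h | h
        · exact ⟨a, by simp, by simpa using h⟩
        · exact ⟨b, by simp, by simpa using h⟩
    · exact fun v hv w hw => h4 v hv w (by simpa using hw.1) hw.2
  have hcover : S ⊆ M.edgeSet.toFinset.biUnion Sym2.toFinset := fun v hv => by
    obtain ⟨w, hw, -⟩ := h2 v hv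
    refine mem_biUnion.2 ⟨s(v, w), ?_, by simp⟩
    simpa using (hadj v w).2 ⟨hv, hw⟩
  have hcard : #S ≤ #M.edgeSet.toFinset * 2 :=
    (card_le_card hcover).trans <| card_biUnion_le_card_mul _ _ _ fun e _ => by
      rw [Sym2.card_toFinset]; split_ifs <;> norm_num
  have := (isGreatest_matchingNumber G I).2 hmem
  rw [Set.ncard_eq_toFinset_card'] at this
  omega

lemma isMaxIndepIn_of_mem_maxIndepSets {I : Set V} (hI : I ∈ maxIndepSets G) :
    IsMaxIndepIn G univ I.toFinset := by
  obtain ⟨h1, h2⟩ : G.IsIndepSet I ∧ ∀ J : Set V, G.IsIndepSet J → I ≤ J → J ≤ I :=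
    ⟨hI.1, fun J hJ => hI.2 hJ⟩
  refine ⟨subset_univ _, fun x hx y hy hxy => ?_, fun x _ hx => ?_⟩
  · exact h1 (by simpa using hx) (by simpa using hy) hxy.ne hxy
  · by_contra! hc
    have hc' : ∀ y ∈ I, ¬ G.Adj x y := fun y hy => hc y (by simpa using hy)
    refine hx ?_
    rw [Set.mem_toFinset]
    refine h2 (insert x I) ?_ (Set.subset_insert x I) (Set.mem_insert x I)
    refine Set.Pairwise.insert h1 fun y hy _ => ⟨hc' y hy, fun h => hc' y hy h.symm⟩

lemma ncard_le_card_family (A : Set (Set V)) (s : ℝ)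
    (hA : ∀ I ∈ A, I ∈ maxIndepSets G ∧ 2 * (matchingNumber G I : ℝ) ≤ s) :
    A.ncard ≤ #(family G univ s) := by
  rw [← Set.ncard_coe_finset]
  refine Set.ncard_le_ncard_of_injOn (fun I => I.toFinset) (fun I hI => ?_)
    (fun I _ J _ h => by simpa using h)
  refine mem_coe.2 (mem_family.2 ⟨isMaxIndepIn_of_mem_maxIndepSets (hA I hI).1, fun S hS => ?_⟩)
  refine le_trans ?_ (hA I hI).2
  exact_mod_cast hS.card_le

end Bridge

/-! ### Regularity and triangle-freeness of the cube -/

section Cube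

open Classical Finset

variable {n : ℕ}

lemma cube_adj_iff {x y : Fin n → Bool} :
    (cube n).Adj x y ↔ ∃ i, y = Function.update x i (!x i) := by
  change hammingDist x y = 1 ↔ _
  rw [hammingDist, card_eq_one]
  refine exists_congr fun i => ⟨fun h => ?_, ?_⟩
  · ext j
    have hj : x j ≠ y j ↔ j = i := by
      have := Finset.ext_iff.1 h j
      simpa using this
    by_cases hji : j = i
    · subst hji
      have := hj.2 rfl
      rw [Function.update_self]
      cases hx : x j <;> cases hy : y j <;> simp_all
    · rw [Function.update_of_ne hji]
      exact (not_not.1 (mt hj.1 hji)).symm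
  · rintro rfl
    ext j
    by_cases hji : j = i
    · subst hji; simp
    · simp [hji]

lemma card_nbrs_cube (x : Fin n → Bool) : #(nbrs (cube n) univ x) = n := by
  have h : nbrs (cube n) univ x = univ.image fun i => Function.update x i (!x i) := by
    ext y
    simp [mem_nbrs, cube_adj_iff, eq_comm]
  rw [h, card_image_of_injective, card_univ, Fintype.card_fin]
  intro i j hij
  by_contra hne
  have := congrFun hij i
  simp [Function.update_of_ne hne] at this

lemma cube_triangleFree (a b c : Fin n → Bool) (hab : (cube n).Adj a b) (hbc : (cube n).Adj b c) :
    ¬ (cube n).Adj a c := by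
  obtain ⟨i, rfl⟩ := cube_adj_iff.1 hab
  obtain ⟨j, rfl⟩ := cube_adj_iff.1 hbc
  rw [cube_adj_iff]
  rintro ⟨k, hk⟩
  have hne : ∀ m, Function.update a k (!a k) m ≠ a m → m = k := fun m hm => by
    by_contra hmk
    exact hm (Function.update_of_ne hmk _ _)
  rw [← hk] at hne
  by_cases hij : j = i
  · subst hij
    have := congrFun hk k
    simp at this
  · have hi : i = k := hne i (by simp [Function.update_of_ne (Ne.symm hij)])
    have hj : j = k := hne j (by simp [Function.update_of_ne hij])
    exact hij (hj.trans hi.symm)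

end Cube
end HammingMIS
namespace HammingMIS

/-! ### Parameters and asymptotics -/

section Counting

open Finset

/-- The maximal independent sets of the cube outside `largeMatchingSets`, counted by branching on
vertices of large degree and then applying the stability bound. -/
lemma ncard_diff_le {n : ℕ} (hn : 2 ≤ n) :
    ((maxIndepSets (cube n) \ largeMatchingSets n).ncard : ℝ) ≤
      mu ^ ((1 - logRatio n) * ((2 : ℝ) ^ n / 2)) * (7 / 5 : ℝ) ^ ((2 : ℝ) ^ n / 2 + 2 ^ n / n) *
        ((1 + 1 / (n : ℝ)) ^ (2 ^ n) * (n : ℝ) ^ ⌈(2 : ℝ) ^ n * Real.log n / (2 * n)⌉₊) := by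
  set s : ℝ := (1 - logRatio n) * ((2 : ℝ) ^ n / 2)
  set k := ⌈(2 : ℝ) ^ n * Real.log n / (2 * n)⌉₊ with hk
  have hn0 : (0 : ℝ) < n := by positivity
  have hN : (Fintype.card (Fin n → Bool) : ℝ) = 2 ^ n := by simp
  have hle : (maxIndepSets (cube n) \ largeMatchingSets n).ncard ≤
      #(family (cube n) univ s) := by
    refine ncard_le_card_family _ s fun I hI => ⟨hI.1, ?_⟩
    have h : ¬ ((matchingNumber (cube n) I : ℝ) > (1 - logRatio n) * ((2 : ℝ) ^ n / 4)) :=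
      fun h => hI.2 ⟨hI.1, h⟩
    simp only [s]
    linarith
  have hkey := card_family_le_of_regular (G := cube n) (s := s) (r := 2 ^ n / n) (p := 1 / n)
    (B := mu ^ s * (7 / 5 : ℝ) ^ ((2 : ℝ) ^ n / 2 + 2 ^ n / n)) card_nbrs_cube (by positivity)
    (by positivity) (by rw [div_le_one hn0]; exact_mod_cast (by omega : 1 ≤ n))
    (fun Y hY => by
      refine (card_family_le cube_triangleFree Y s).trans ?_
      refine mul_le_mul_of_nonneg_left ?_ (Real.rpow_pos_of_pos mu_pos s).le
      rw [hN] at hY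
      rw [← Real.rpow_natCast]
      exact Real.rpow_le_rpow_of_exponent_le (by norm_num) hY) k univ (by
    rw [card_univ, hN]
    -- `k` is chosen so that the initial excess `N / 2` shrinks by a factor `n`, to below `r = N /
    -- n`.
    have h1 : Real.log n ≤ 2 * n * k / 2 ^ n := by
      have h2 : (2 : ℝ) ^ n * Real.log n / (2 * n) ≤ k := Nat.le_ceil _
      rw [div_le_iff₀ (by positivity)] at h2
      rw [le_div_iff₀ (by positivity)]
      linarith
    have h3 : Real.exp (-(2 * n * k / 2 ^ n)) ≤ 1 / n := by
      refine (Real.exp_le_exp.2 (neg_le_neg h1)).trans ?_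
      rw [Real.exp_neg, Real.exp_log hn0, one_div]
    refine (mul_le_mul_of_nonneg_left h3 ?_).trans ?_
    · linarith [pow_pos (two_pos : (0 : ℝ) < 2) n]
    · rw [mul_one_div]
      gcongr
      linarith [pow_pos (two_pos : (0 : ℝ) < 2) n])
  have hc : #(univ : Finset (Fin n → Bool)) = 2 ^ n := by simp
  rw [hc, one_div, inv_inv] at hkey
  rw [one_div]
  exact (Nat.cast_le.2 hle).trans hkey

lemma logb_mu_pos : 0 < Real.logb 2 mu := Real.logb_pos (by norm_num) one_lt_mu

lemma two_rpow_logb_mu : (2 : ℝ) ^ Real.logb 2 mu = mu :=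
  Real.rpow_logb (by norm_num) (by norm_num) mu_pos

lemma two_rpow_half_sub_logb_mu : (2 : ℝ) ^ (1 / 2 - Real.logb 2 mu) = 7 / 5 := by
  have h : (0 : ℝ) < √2 := by positivity
  rw [Real.rpow_sub two_pos, two_rpow_logb_mu, ← Real.sqrt_eq_rpow, mu]
  field_simp

lemma one_add_inv_pow_le {n : ℕ} (hn : 0 < n) (m : ℕ) :
    (1 + 1 / (n : ℝ)) ^ m ≤ (2 : ℝ) ^ (2 * m / n : ℝ) := by
  have hexp : Real.exp 1 ≤ 2 ^ (2 : ℝ) := by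
    rw [Real.rpow_two]; linarith [Real.exp_one_lt_d9]
  calc (1 + 1 / (n : ℝ)) ^ m ≤ Real.exp (1 / n) ^ m := by
        refine pow_le_pow_left₀ (by positivity) ?_ m
        rw [add_comm]; exact Real.add_one_le_exp _
    _ = Real.exp 1 ^ (m / n : ℝ) := by
        rw [← Real.exp_nat_mul, ← Real.exp_mul]; congr 1; ring
    _ ≤ (2 ^ (2 : ℝ)) ^ (m / n : ℝ) := by
        exact Real.rpow_le_rpow (Real.exp_pos 1).le hexp (by positivity)
    _ = (2 : ℝ) ^ (2 * m / n : ℝ) := by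
        rw [← Real.rpow_mul two_pos.le]; congr 1; ring

lemma one_le_logb {n : ℕ} (hn : 2 ≤ n) : 1 ≤ Real.logb 2 n := by
  rw [Real.le_logb_iff_rpow_le one_lt_two (by positivity), Real.rpow_one]
  exact_mod_cast hn

lemma ceil_mul_log_le {n : ℕ} (hn : 2 ≤ n) :
    (⌈(2 : ℝ) ^ n * Real.log n / (2 * n)⌉₊ : ℝ) ≤ 2 ^ n * Real.logb 2 n / n := by
  have hn0 : (0 : ℝ) < n := by positivity
  have hL := one_le_logb hn
  have hlog0 : 0 ≤ Real.log n := Real.log_natCast_nonneg n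
  have hlog : Real.log n ≤ Real.logb 2 n := by
    rw [Real.logb, le_div_iff₀ (Real.log_pos one_lt_two)]
    nlinarith [Real.log_two_lt_d9]
  have hN : 2 * (n : ℝ) ≤ 2 ^ n := by
    obtain ⟨m, rfl⟩ : ∃ m, n = m + 1 := ⟨n - 1, by omega⟩
    have : m + 1 ≤ 2 ^ m := Nat.lt_two_pow_self
    rw [pow_succ, mul_comm]
    exact_mod_cast Nat.mul_le_mul_right 2 this
  have h1 := (Nat.ceil_lt_add_one
    (by positivity : 0 ≤ (2 : ℝ) ^ n * Real.log n / (2 * n))).le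
  refine h1.trans ?_
  have h2 : (2 : ℝ) ^ n * Real.log n / (2 * n) ≤ 2 ^ n * Real.logb 2 n / (2 * n) := by gcongr
  -- Half of the target absorbs the 1 lost to the ceiling.
  have h3 : (1 : ℝ) ≤ 2 ^ n * Real.logb 2 n / (2 * n) := by
    rw [one_le_div (by positivity)]
    nlinarith
  have h4 : (2 : ℝ) ^ n * Real.logb 2 n / n = 2 ^ n * Real.logb 2 n / (2 * n) +
    2 ^ n * Real.logb 2 n / (2 * n) := by field_simp; ring
  linarith

lemma ncard_diff_lt {n : ℕ} (hn : 2 ≤ n) (hL : 16 / Real.logb 2 mu < Real.logb 2 n) :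
    ((maxIndepSets (cube n) \ largeMatchingSets n).ncard : ℝ) <
      (2 : ℝ) ^ ((1 - Real.logb 2 mu * logRatio n) * ((2 : ℝ) ^ n / 4)) := by
  have hn0 : (0 : ℝ) < n := by positivity
  have hL1 := one_le_logb hn
  have ha := logb_mu_pos
  have hk := ceil_mul_log_le hn
  set k := ⌈(2 : ℝ) ^ n * Real.log n / (2 * n)⌉₊
  set a := Real.logb 2 mu with ha'
  set L := Real.logb 2 n with hL'
  set N : ℝ := (2 : ℝ) ^ n with hN
  have hN0 : 0 < N := by positivity
  have hpow : (n : ℝ) ^ k ≤ 2 ^ (L * (N * L / n)) := by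
    calc (n : ℝ) ^ k = (2 ^ L) ^ (k : ℝ) := by
          rw [hL', Real.rpow_logb two_pos (by norm_num) hn0, Real.rpow_natCast]
      _ = 2 ^ (L * k) := (Real.rpow_mul two_pos.le _ _).symm
      _ ≤ _ := Real.rpow_le_rpow_of_exponent_le one_le_two
          (mul_le_mul_of_nonneg_left hk (by linarith))
  have hone : (1 + 1 / (n : ℝ)) ^ (2 ^ n) ≤ 2 ^ (2 * N / n) := by
    simpa [hN] using one_add_inv_pow_le (by omega : 0 < n) (2 ^ n)
  have hmu : mu ^ ((1 - logRatio n) * (N / 2)) = 2 ^ (a * ((1 - logRatio n) * (N / 2))) := by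
    rw [Real.rpow_mul two_pos.le, ha', two_rpow_logb_mu]
  have hbeta : (7 / 5 : ℝ) ^ (N / 2 + N / n) = 2 ^ ((1 / 2 - a) * (N / 2 + N / n)) := by
    rw [Real.rpow_mul two_pos.le, ha', two_rpow_half_sub_logb_mu]
  have hmain := ncard_diff_le hn
  rw [hmu, hbeta] at hmain
  refine hmain.trans_lt (lt_of_le_of_lt (mul_le_mul_of_nonneg_left
    (mul_le_mul hone hpow (by positivity) (by positivity)) (by positivity)) ?_)
  rw [← Real.rpow_add two_pos, ← Real.rpow_add two_pos, ← Real.rpow_add two_pos]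
  refine Real.rpow_lt_rpow_of_exponent_lt one_lt_two ?_
  have hr : logRatio n = L ^ 3 / n := rfl
  have haL : 16 < a * L := by rwa [div_lt_iff₀ ha, mul_comm] at hL
  -- Half of the saving, `a L³ / 4` in units of `N / n`, beats the cost `L² + 3`: it exceeds `4 L²`
  -- by the threshold 16, and `L ≥ 1`. The other half remains in the final exponent, whence `c = a`.
  have hcmp : 3 + L ^ 2 - a * L ^ 3 / 4 < 0 := by
    have h1 : 16 * L ^ 2 < a * L * L ^ 2 := mul_lt_mul_of_pos_right haL (by positivity)
    nlinarith
  have hneg : (3 + L ^ 2 - a * L ^ 3 / 4) * (N / n) < 0 :=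
    mul_neg_of_neg_of_pos hcmp (by positivity)
  have haN : 0 < a * (N / n) := by positivity
  have hNn : 0 < N / n := by positivity
  rw [hr]
  have hid : a * ((1 - L ^ 3 / n) * (N / 2)) + (1 / 2 - a) * (N / 2 + N / n) +
      (2 * N / n + L * (N * L / n)) = (1 - a * (L ^ 3 / n)) * (N / 4) +
      (3 + L ^ 2 - a * L ^ 3 / 4) * (N / n) - a * (N / n) - 1 / 2 * (N / n) := by ring
  rw [hid]
  linarith

lemma tendsto_logb_natCast_atTop :
    Filter.Tendsto (fun n : ℕ => Real.logb 2 n) Filter.atTop Filter.atTop :=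
  (Real.tendsto_logb_atTop one_lt_two).comp tendsto_natCast_atTop_atTop

/-- This makes the saving in the exponent unbounded, as the little-o statement requires. -/
lemma logb_le_logRatio_mul {n : ℕ} (hn : 2 ≤ n) : Real.logb 2 n ≤ logRatio n * 2 ^ n := by
  have hL := one_le_logb hn
  have hn0 : (0 : ℝ) < n := by positivity
  have hN : (n : ℝ) ≤ 2 ^ n := by exact_mod_cast Nat.lt_two_pow_self.le
  have h1 : Real.logb 2 n ≤ Real.logb 2 n ^ 3 := le_self_pow₀ hL (by norm_num)
  rw [logRatio, div_mul_eq_mul_div, le_div_iff₀ hn0]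
  exact mul_le_mul h1 hN hn0.le (by positivity)

end Counting
end HammingMIS

open scoped Asymptotics
theorem lemma1p2 :
    (fun n : ℕ =>
        ((HammingMIS.maxIndepSets (HammingMIS.cube n) \ HammingMIS.largeMatchingSets n).ncard : ℝ))
      =o[Filter.atTop] (fun n : ℕ => (2 : ℝ) ^ ((2 : ℝ) ^ n / 4)) ∧
    ∃ c : ℝ, 0 < c ∧ ∃ n₀ : ℕ, ∀ n : ℕ, n₀ ≤ n →
      ((HammingMIS.maxIndepSets (HammingMIS.cube n) \ HammingMIS.largeMatchingSets n).ncard : ℝ) <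
        (2 : ℝ) ^ ((1 - c * HammingMIS.logRatio n) * ((2 : ℝ) ^ n / 4)) := by
  have ha := HammingMIS.logb_mu_pos
  have hlt : ∀ᶠ n : ℕ in Filter.atTop,
      ((HammingMIS.maxIndepSets (HammingMIS.cube n) \ HammingMIS.largeMatchingSets n).ncard : ℝ) <
        (2 : ℝ) ^ ((1 - Real.logb 2 HammingMIS.mu * HammingMIS.logRatio n) *
          ((2 : ℝ) ^ n / 4)) := by
    filter_upwards [Filter.eventually_ge_atTop 2,
      HammingMIS.tendsto_logb_natCast_atTop.eventually_gt_atTop _] with n hn hL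
    exact HammingMIS.ncard_diff_lt hn hL
  refine ⟨Asymptotics.isLittleO_iff.2 fun c hc => ?_, _, ha, Filter.eventually_atTop.1 hlt⟩
  -- The threshold on `log n` makes the saving `a * logRatio n * N / 4` at least `-log c`.
  filter_upwards [hlt, Filter.eventually_ge_atTop 2,
    HammingMIS.tendsto_logb_natCast_atTop.eventually_ge_atTop
      (4 * -Real.logb 2 c / Real.logb 2 HammingMIS.mu)] with n hn h2 hL
  have hLN := HammingMIS.logb_le_logRatio_mul h2
  set a := Real.logb 2 HammingMIS.mu
  rw [div_le_iff₀ ha] at hL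
  rw [Real.norm_of_nonneg (by positivity), Real.norm_of_nonneg (by positivity)]
  refine hn.le.trans ?_
  rw [← Real.rpow_logb two_pos (by norm_num : (2 : ℝ) ≠ 1) hc, ← Real.rpow_add two_pos]
  refine Real.rpow_le_rpow_of_exponent_le one_le_two ?_
  have h3 := mul_le_mul_of_nonneg_left hLN ha.le
  linarith
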